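/- Let $n\ge 0$, let $(X_i,d_i)$, $i=1,\dots,n$, be nonempty metric spaces (strategy sets), let $u_i:X_1\times\dots\times X_n\to\mathbb R$ be arbitrary payoff functions, and let $X=X_1\times\dots\times X_n$ carry the $\ell^p$ product metric $d$ of the $d_i$ for some fixed $p\in[1,\infty]$ (so the maximum, sum and Euclidean product metrics are all allowed). Put $BR_i(\mathbf x)=\{a\in X_i: u_i(a,\mathbf x_{-i})\ge u_i(b,\mathbf x_{-i})\text{ for all }b\in X_i\}$ and $BR(\mathbf x)=BR_1(\mathbf x)\times\dots\times BR_n(\mathbf x)$, and assume that $BR(\mathbf x)$ is nonempty and compact for every $\mathbf x\in X$. Let $H$ denote the Hausdorff distance of $d$. The length $l(\gamma)$ of a continuous path $\gamma:[0,1]\to X$ is $\sup\sum_k d(\gamma(t_{k-1}),\gamma(t_k))$ over all partitions of $[0,1]$; $X$ is rectifiably path-connected if any two of its points are joined by a continuous path of finite length, and then $d_r(\mathbf x,\mathbf y)$ is the infimum of the lengths of all such paths from $\mathbf x$ to $\mathbf y$, with Hausdorff distance $H_r$. Suppose that one of the following holds. (a) $(X,d)$ is compact; for every $\mathbf x\in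 X$ there are $\beta_{\mathbf x}\in[0,1)$ and $r_{\mathbf x}>0$ such that $H(BR(\mathbf y),BR(\mathbf z))\le\beta_{\mathbf x}\,d(\mathbf y,\mathbf z)$ for all $\mathbf y,\mathbf z$ with $d(\mathbf x,\mathbf y)\le r_{\mathbf x}$ and $d(\mathbf x,\mathbf z)\le r_{\mathbf x}$ (local set-valued contraction); and for some $r>0$ with $r\le r_{\mathbf x}$ for all $\mathbf x\in X$ the space $X$ is $r$-chainable, i.e. any $\mathbf x,\mathbf y\in X$ are joined by a finite chain $\mathbf x=\mathbf z_0,\dots,\mathbf z_m=\mathbf y$ in $X$ with $d(\mathbf z_{k-1},\mathbf z_k)<r$ for all $k$. (b) $(X,d)$ is complete and rectifiably path-connected, and $BR$ is a uniform pointwise contraction: there is $\beta\in[0,1)$ such that every $\mathbf x\in X$ has an open neighbourhood $N(\mathbf x)$ with $H(BR(\mathbf x),BR(\mathbf y))\le\beta\, d(\mathbf x,\mathbf y)$ for all $\mathbf y\in N(\mathbf x)$. (c) $X$ is rectifiably path-connected, $(X,d_r)$ is compact, and $BR$ is a pointwise contraction with respect to $d$ and $H$, or with respect to $d_r$ and $H_r$: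 for every $\mathbf x\in X$ there are $\beta_{\mathbf x}\in[0,1)$ and a neighbourhood $N(\mathbf x)$, open in the metric in question, such that the Hausdorff distance of $BR(\mathbf x)$ and $BR(\mathbf y)$ is at most $\beta_{\mathbf x}$ times the distance of $\mathbf x$ and $\mathbf y$ for all $\mathbf y\in N(\mathbf x)$. Then the game has a pure-strategy Nash equilibrium: there is $\mathbf x^*\in X$ with $\mathbf x^*\in BR(\mathbf x^*)$, i.e. no player can gain by a unilateral deviation from $\mathbf x^*$. -/

import Mathlib

open Set
open scoped ENNReal NNReal

/-! ### Metric notions: chains, length of paths, the length metric -/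

/-- `X` is `r`-chainable: any two points are joined by a finite chain of points
with consecutive distances less than `r`. -/
def IsChainable (X : Type*) [PseudoMetricSpace X] (r : ℝ) : Prop :=
  ∀ x y : X, ∃ (n : ℕ) (z : ℕ → X), z 0 = x ∧ z n = y ∧ ∀ i < n, dist (z i) (z (i + 1)) < r

/-- The length of a path: the supremum over all partitions of `[0,1]` of the sum of the
distances between consecutive points. -/
noncomputable def pathLength {X : Type*} [PseudoEMetricSpace X] {x y : X} (γ : Path x y) : ℝ≥0∞ :=
  eVariationOn γ univ

/-- Any two points are joined by a continuous path of finite length. -/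
def IsRectifiablyPathConnected (X : Type*) [PseudoEMetricSpace X] : Prop :=
  ∀ x y : X, ∃ γ : Path x y, pathLength γ < ∞

section PathLength

variable {X : Type*} [PseudoEMetricSpace X]

theorem edist_le_pathLength {x y : X} (γ : Path x y) : edist x y ≤ pathLength γ := by
  have h := eVariationOn.edist_le (γ : unitInterval → X) (s := univ) (mem_univ 0) (mem_univ 1)
  simpa [pathLength] using h

theorem pathLength_refl (x : X) : pathLength (Path.refl x) = 0 := by
  refine eVariationOn.constant_on ?_
  rintro _ ⟨s, -, rfl⟩ _ ⟨t, -, rfl⟩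
  simp

theorem pathLength_symm_le {x y : X} (γ : Path x y) : pathLength γ.symm ≤ pathLength γ := by
  have h := eVariationOn.comp_le_of_antitoneOn (γ : unitInterval → X) (s := univ) (t := univ)
    unitInterval.symm (fun a _ b _ hab => unitInterval.symm_le_symm.2 hab)
    (fun _ _ => mem_univ _)
  exact h

theorem pathLength_trans_le {x y z : X} (γ : Path x y) (δ : Path y z) :
    pathLength (γ.trans δ) ≤ pathLength γ + pathLength δ := by
  let m : unitInterval := ⟨1 / 2, by norm_num, by norm_num⟩
  have hsplit : eVariationOn (γ.trans δ : unitInterval → X) univ =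
      eVariationOn (γ.trans δ : unitInterval → X) (Iic m) +
        eVariationOn (γ.trans δ : unitInterval → X) (Ici m) := by
    rw [← eVariationOn.union (γ.trans δ : unitInterval → X) (x := m) isGreatest_Iic isLeast_Ici,
      Iic_union_Ici]
  unfold pathLength
  rw [hsplit]
  refine add_le_add ?_ ?_
  · let φ : unitInterval → unitInterval := fun t => projIcc 0 1 zero_le_one (2 * (t : ℝ))
    have hφ : Monotone φ := fun a b hab =>
      monotone_projIcc _ (mul_le_mul_of_nonneg_left (by exact_mod_cast hab) (by norm_num))
    have heq : EqOn (γ.trans δ : unitInterval → X) ((γ : unitInterval → X) ∘ φ) (Iic m) := by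
      intro t ht
      have ht' : (t : ℝ) ≤ 1 / 2 := ht
      rw [Path.trans_apply, dif_pos ht']
      refine congrArg γ ?_
      exact (projIcc_of_mem zero_le_one _).symm
    rw [eVariationOn.congr heq]
    exact eVariationOn.comp_le_of_monotoneOn _ _ (hφ.monotoneOn _) (fun _ _ => mem_univ _)
  · let φ : unitInterval → unitInterval := fun t => projIcc 0 1 zero_le_one (2 * (t : ℝ) - 1)
    have hφ : Monotone φ := fun a b hab =>
      monotone_projIcc _ (sub_le_sub_right
        (mul_le_mul_of_nonneg_left (by exact_mod_cast hab) (by norm_num)) _)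
    have heq : EqOn (γ.trans δ : unitInterval → X) ((δ : unitInterval → X) ∘ φ) (Ici m) := by
      intro t ht
      have ht' : 1 / 2 ≤ (t : ℝ) := ht
      rcases ht'.eq_or_lt with h | h
      · have hp : φ t = 0 := by
          refine Subtype.ext ?_
          simp only [φ, coe_projIcc, ← h]
          norm_num
        rw [Path.trans_apply, dif_pos h.ge, Function.comp_apply, hp, δ.source]
        convert γ.target using 2
        refine Subtype.ext ?_
        simp [← h]
      · rw [Path.trans_apply, dif_neg (not_le.2 h)]
        refine congrArg δ ?_
        exact (projIcc_of_mem zero_le_one _).symm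
    rw [eVariationOn.congr heq]
    exact eVariationOn.comp_le_of_monotoneOn _ _ (hφ.monotoneOn _) (fun _ _ => mem_univ _)

end PathLength

/-- The set `X`, to be equipped with the length metric `d_r` instead of its metric `d`. -/
def LengthSpace (X : Type*) : Type _ := X

/-- The length metric `d_r(x, y)`: the infimum of the lengths (with respect to `d`) of the
`d`-continuous paths from `x` to `y`. It is finite for all `x`, `y` exactly if `X` is rectifiably
path-connected. -/
noncomputable instance (X : Type*) [EMetricSpace X] : EMetricSpace (LengthSpace X) where
  edist x y := ⨅ γ : Path (X := X) x y, pathLength γ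
  edist_self x := le_antisymm ((iInf_le _ (Path.refl (X := X) x)).trans
    (pathLength_refl (X := X) x).le) zero_le
  edist_comm x y := le_antisymm
    (le_iInf fun γ => (iInf_le _ γ.symm).trans (pathLength_symm_le γ))
    (le_iInf fun γ => (iInf_le _ γ.symm).trans (pathLength_symm_le γ))
  edist_triangle x y z := by
    rw [ENNReal.iInf_add]
    refine le_iInf fun γ => ?_
    rw [ENNReal.add_iInf]
    exact le_iInf fun δ => (iInf_le _ (γ.trans δ)).trans (pathLength_trans_le γ δ)
  eq_of_edist_eq_zero {x y} h := by
    have h' : edist (α := X) x y ≤ 0 :=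
      (le_iInf fun γ => edist_le_pathLength γ).trans (le_of_eq h)
    exact edist_eq_zero (γ := X).1 (le_antisymm h' zero_le)

/-- A set-valued map on `(X, d)`, regarded as a set-valued map on `(X, d_r)`. -/
def onLengthSpace {X : Type*} (F : X → Set X) : LengthSpace X → Set (LengthSpace X) := F

/-! ### Set-valued contractions -/

/-- The set of fixed points of a set-valued map. -/
def setFix {X : Type*} (F : X → Set X) : Set X := {x | x ∈ F x}

section Contractions

variable {X : Type*}

/-- `F` is a set-valued contraction of modulus `β < 1` on `s`, with respect to the Hausdorff
distance. -/
def IsSetContractionOn [PseudoEMetricSpace X] (β : ℝ≥0) (F : X → Set X) (s : Set X) : Prop :=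
  β < 1 ∧ ∀ x ∈ s, ∀ y ∈ s, Metric.hausdorffEDist (F x) (F y) ≤ β * edist x y

/-- `F` is a set-valued `(β x, ρ x)`-local contraction: around each `x` it is a contraction of
modulus `β x` in the ball `{z | d(x, z) ≤ ρ x}`. -/
def IsSetLocalContraction [PseudoMetricSpace X] (β : X → ℝ≥0) (ρ : X → ℝ) (F : X → Set X) :
    Prop :=
  ∀ x, 0 < ρ x ∧ IsSetContractionOn (β x) F (Metric.closedBall x (ρ x))

/-- `F` is a set-valued pointwise contraction. -/
def IsSetPointwiseContraction [PseudoEMetricSpace X] (F : X → Set X) : Prop :=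
  ∀ x, ∃ β : ℝ≥0, β < 1 ∧ ∃ N : Set X, IsOpen N ∧ x ∈ N ∧
    ∀ y ∈ N, Metric.hausdorffEDist (F x) (F y) ≤ β * edist x y

/-- `F` is a set-valued uniform pointwise contraction: the modulus does not depend on `x`. -/
def IsSetUniformPointwiseContraction [PseudoEMetricSpace X] (F : X → Set X) : Prop :=
  ∃ β : ℝ≥0, β < 1 ∧ ∀ x, ∃ N : Set X, IsOpen N ∧ x ∈ N ∧
    ∀ y ∈ N, Metric.hausdorffEDist (F x) (F y) ≤ β * edist x y

end Contractions

/-! ### Strategic games -/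

section Games

variable {n : ℕ} {S : Fin n → Type*}

/-- Best responses of player `i` to the profile `x` (the entry `x i` plays no role). -/
def bestResponseOf (u : Fin n → (∀ i, S i) → ℝ) (i : Fin n) (x : ∀ i, S i) : Set (S i) :=
  {a | ∀ b : S i, u i (Function.update x i b) ≤ u i (Function.update x i a)}

/-- The best response of the game, `BR(x) = BR_1(x) × ... × BR_n(x)`, as a set-valued map on the
product of the strategy sets with the `ℓ^p` product metric. -/
def bestResponse (p : ℝ≥0∞) (u : Fin n → (∀ i, S i) → ℝ) (x : PiLp p S) : Set (PiLp p S) :=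
  {y | ∀ i, y i ∈ bestResponseOf u i (fun j => x j)}

/-- `x` is a pure-strategy Nash equilibrium: no player gains by deviating unilaterally. -/
def IsPureNash (u : Fin n → (∀ i, S i) → ℝ) (x : ∀ i, S i) : Prop :=
  ∀ i, ∀ b : S i, u i (Function.update x i b) ≤ u i x

end Games

open Filter Topology Metric unitInterval

/-! ### Selections of set-valued maps on the unit interval -/

/-! A Nash equilibrium is a fixed point of the best response, so each case is a fixed point theorem
for a set-valued map `F` with nonempty compact values. The common device is lifting: a chain or path
from `x` to `y ∈ F x` is followed, through nearest points or a selection of `F` along it, by one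
from `y` to a point of `F y`, and contraction makes the lift shorter.

(a) Among chains of a fixed number of steps of size at most `r` that end in the image of their
start, one has minimal total length by compactness. Its lift is again admissible and strictly
shorter unless the chain is constant, and a constant chain is a fixed point
(`setFix_nonempty_of_chainable`).

(b) Lifting repeatedly multiplies the length bound by `β` each time. The endpoints form a Cauchy
sequence, and its limit is fixed because the graph is closed (`setFix_nonempty_of_uniform`).

(c) Minimise `d_r (x, y)` over the compact graph. If the minimum is attained at `x ≠ y`, a
`d_r`-geodesic from `x` to `y` lifts to a strictly shorter path from `y` into `F y`, a
contradiction. The moduli are not uniform, but by Baire one modulus below 1 serves on a whole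
subinterval of the geodesic, and the rest is not lengthened
(`IsSetPointwiseContraction.exists_path_lt`).

Path lifting rests on `exists_selection_of_eventually`: nearest points give selections controlled at
finitely many times, and Tychonoff passes to all times. -/

theorem ofReal_sub_add_ofReal_sub {a b c : ℝ} (hab : a ≤ b) (hbc : b ≤ c) :
    ENNReal.ofReal (b - a) + ENNReal.ofReal (c - b) = ENNReal.ofReal (c - a) := by
  rw [← ENNReal.ofReal_add (sub_nonneg.2 hab) (sub_nonneg.2 hbc)]
  congr 1
  ring

section Selection

variable {X : Type*} [EMetricSpace X] {K : I → Set X} {v : I → ℝ}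

/-- Times are added in increasing order, each new value being chosen from the value at the preceding
time `p` only. Since increments of `v` add up, the triangle inequality extends the bound to all
earlier times. Off `insert 0 T` the values only have to lie in `K t`. -/
theorem exists_selection_finset (hv : Monotone v)
    (h : ∀ s t, s ≤ t → ∀ a ∈ K s, ∃ b ∈ K t, edist a b ≤ ENNReal.ofReal (v t - v s))
    {a : X} (ha : a ∈ K 0) (T : Finset I) :
    ∃ w : I → X, w 0 = a ∧ (∀ t, w t ∈ K t) ∧ ∀ s ∈ insert 0 T, ∀ t ∈ insert 0 T, s ≤ t →
      edist (w s) (w t) ≤ ENNReal.ofReal (v t - v s) := by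
  classical
  induction T using Finset.induction_on_max with
  | empty =>
    choose b hb _ using fun t => h 0 t t.2.1 a ha
    refine ⟨Function.update b 0 a, by simp, fun t => ?_, ?_⟩
    · rcases eq_or_ne t 0 with rfl | ht
      · simpa using ha
      · simpa [ht] using hb t
    · simp
  | insert m T hm ih =>
    obtain ⟨w, hw0, hwK, hw⟩ := ih
    rcases eq_or_ne m 0 with rfl | hm0
    · exact ⟨w, hw0, hwK, by simpa using hw⟩
    have hm' : ∀ x ∈ insert 0 T, x < m := by
      intro x hx
      rcases Finset.mem_insert.1 hx with rfl | hx
      · exact unitInterval.pos_iff_ne_zero.2 hm0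
      · exact hm x hx
    let p := (insert 0 T).max' (Finset.insert_nonempty 0 T)
    have hp : p ∈ insert 0 T := Finset.max'_mem _ _
    obtain ⟨b, hbK, hb⟩ := h p m (hm' p hp).le (w p) (hwK p)
    have hlast : ∀ s ∈ insert 0 T, edist (w s) b ≤ ENNReal.ofReal (v m - v s) := by
      intro s hs
      have hsp : s ≤ p := Finset.le_max' _ _ hs
      calc edist (w s) b ≤ edist (w s) (w p) + edist (w p) b := edist_triangle _ _ _
        _ ≤ _ := add_le_add (hw s hs p hp hsp) hb
        _ = _ := ofReal_sub_add_ofReal_sub (hv hsp) (hv (hm' p hp).le)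
    refine ⟨Function.update w m b, ?_, fun t => ?_, ?_⟩
    · rw [Function.update_of_ne (Ne.symm hm0), hw0]
    · rcases eq_or_ne t m with rfl | ht
      · simpa using hbK
      · simpa [ht] using hwK t
    · rw [Finset.insert_comm]
      intro s hs t ht hst
      rcases Finset.mem_insert.1 hs with rfl | hs' <;>
        rcases Finset.mem_insert.1 ht with rfl | ht'
      · simp
      · exact absurd hst (hm' t ht').not_ge
      · rw [Function.update_of_ne (hm' s hs').ne, Function.update_self]
        exact hlast s hs'
      · rw [Function.update_of_ne (hm' s hs').ne, Function.update_of_ne (hm' t ht').ne]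
        exact hw s hs' t ht' hst

/-- A compact-valued map on the unit interval that moves by at most `v t - v s` from `s` to `t`
has a selection with the same property, through any given initial point. -/
theorem exists_selection (hK : ∀ t, IsCompact (K t)) (hv : Monotone v)
    (h : ∀ s t, s ≤ t → ∀ a ∈ K s, ∃ b ∈ K t, edist a b ≤ ENNReal.ofReal (v t - v s))
    {a : X} (ha : a ∈ K 0) :
    ∃ w : I → X, w 0 = a ∧ (∀ t, w t ∈ K t) ∧ ∀ s t, s ≤ t →
      edist (w s) (w t) ≤ ENNReal.ofReal (v t - v s) := by
  classical
  have hC : IsCompact (univ.pi K ∩ {w | w 0 = a}) :=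
    (isCompact_univ_pi hK).inter_right (isClosed_eq (continuous_apply 0) continuous_const)
  -- Each constraint on a pair `s ≤ t` is closed in the topology of pointwise convergence, so it
  -- suffices to satisfy finitely many at once.
  obtain ⟨w, ⟨hwK, hw0⟩, hw⟩ := hC.inter_iInter_nonempty
    (fun q : {q : I × I // q.1 ≤ q.2} =>
      {w : I → X | edist (w q.1.1) (w q.1.2) ≤ ENNReal.ofReal (v q.1.2 - v q.1.1)})
    (fun q => isClosed_le (by fun_prop) continuous_const) (fun u => by
      obtain ⟨w, hw0, hwK, hw⟩ := exists_selection_finset hv h ha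
        (u.image (fun q => q.1.1) ∪ u.image (fun q => q.1.2))
      refine ⟨w, ⟨fun t _ => hwK t, hw0⟩, mem_iInter₂.2 fun q hq => ?_⟩
      refine hw _ ?_ _ ?_ q.2
      · exact Finset.mem_insert_of_mem (Finset.mem_union_left _
          (Finset.mem_image_of_mem (fun q : {q : I × I // q.1 ≤ q.2} => q.1.1) hq))
      · exact Finset.mem_insert_of_mem (Finset.mem_union_right _
          (Finset.mem_image_of_mem (fun q : {q : I × I // q.1 ≤ q.2} => q.1.2) hq)))
  exact ⟨w, hw0, fun t => hwK t (mem_univ t), fun s t hst => mem_iInter.1 hw ⟨(s, t), hst⟩⟩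

/-- A pointwise bound on the speed in the Hausdorff distance is a global one. -/
theorem hausdorffEDist_le_of_eventually (hv : Monotone v)
    (h : ∀ t, ∀ᶠ s in 𝓝 t, hausdorffEDist (K t) (K s) ≤ ENNReal.ofReal |v s - v t|)
    {s t : I} (hst : s ≤ t) : hausdorffEDist (K s) (K t) ≤ ENNReal.ofReal (v t - v s) := by
  have step : ∀ {x y}, s ≤ x → x ≤ y →
      hausdorffEDist (K s) (K x) ≤ ENNReal.ofReal (v x - v s) →
      hausdorffEDist (K x) (K y) ≤ ENNReal.ofReal (v y - v x) →
      hausdorffEDist (K s) (K y) ≤ ENNReal.ofReal (v y - v s) := fun hsx hxy h1 h2 =>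
    hausdorffEDist_triangle.trans ((add_le_add h1 h2).trans
      (ofReal_sub_add_ofReal_sub (hv hsx) (hv hxy)).le)
  let A : Set I := {x | x ∈ Icc s t ∧ hausdorffEDist (K s) (K x) ≤ ENNReal.ofReal (v x - v s)}
  have hsA : s ∈ A := ⟨left_mem_Icc.2 hst, by simp⟩
  have hA : IsLUB A (sSup A) := isLUB_csSup ⟨s, hsA⟩ ⟨t, fun x hx => hx.1.2⟩
  set z := sSup A
  have hsz : s ≤ z := hA.1 hsA
  have hzt : z ≤ t := hA.2 fun x hx => hx.1.2
  -- The bound passes to the supremum `z` because the local bound around `z` reaches some point of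
  -- `A` near `z`; the same local bound then carries it beyond `z` if `z < t`.
  have hz : hausdorffEDist (K s) (K z) ≤ ENNReal.ofReal (v z - v s) := by
    obtain ⟨x, hxA, hx⟩ := ((hA.frequently_mem ⟨s, hsA⟩).and_eventually
      (mem_nhdsWithin_of_mem_nhds (h z))).exists
    have hxz : x ≤ z := hA.1 hxA
    refine step hxA.1.1 hxz hxA.2 ?_
    rw [hausdorffEDist_comm]
    rwa [abs_of_nonpos (sub_nonpos.2 (hv hxz)), neg_sub] at hx
  rcases hzt.eq_or_lt with hEq | hlt
  · rwa [hEq] at hz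
  · obtain ⟨y, hy, hyz, hyt⟩ : ∃ y, hausdorffEDist (K z) (K y) ≤ ENNReal.ofReal |v y - v z| ∧
        z < y ∧ y ≤ t := by
      have : (𝓝[>] z).NeBot := nhdsGT_neBot_of_exists_gt ⟨t, hlt⟩
      exact (((h z).filter_mono nhdsWithin_le_nhds).and (Ioc_mem_nhdsGT hlt)).exists
    rw [abs_of_nonneg (sub_nonneg.2 (hv hyz.le))] at hy
    exact absurd (hA.1 ⟨⟨hsz.trans hyz.le, hyt⟩, step hsz hyz.le hz hy⟩) hyz.not_ge

/-- A compact-valued map whose speed in the Hausdorff distance is pointwise bounded by that of `v`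
has a selection through any given initial point whose speed is bounded by that of `v`. -/
theorem exists_selection_of_eventually (hK : ∀ t, IsCompact (K t)) (hv : Monotone v)
    (h : ∀ t, ∀ᶠ s in 𝓝 t, hausdorffEDist (K t) (K s) ≤ ENNReal.ofReal |v s - v t|)
    {a : X} (ha : a ∈ K 0) :
    ∃ w : I → X, w 0 = a ∧ (∀ t, w t ∈ K t) ∧ ∀ s t, s ≤ t →
      edist (w s) (w t) ≤ ENNReal.ofReal (v t - v s) := by
  refine exists_selection hK hv (fun s t hst a ha => ?_) ha
  have hle := hausdorffEDist_le_of_eventually hv h hst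
  -- The Hausdorff distance from a nonempty set to the empty set is infinite, so a finite bound
  -- makes `K t` nonempty.
  have hne := nonempty_of_hausdorffEDist_ne_top ⟨a, ha⟩
    (ne_top_of_le_ne_top ENNReal.ofReal_ne_top hle)
  obtain ⟨b, hb, hab⟩ := (hK t).exists_infEDist_eq_edist hne a
  exact ⟨b, hb, hab ▸ (infEDist_le_hausdorffEDist_of_mem ha).trans hle⟩

end Selection

/-! ### Curves with controlled speed -/

section Curves

variable {X : Type*} [PseudoEMetricSpace X] {w : I → X} {v : I → ℝ}

theorem edist_le_ofReal_abs (hw : ∀ s t, s ≤ t → edist (w s) (w t) ≤ ENNReal.ofReal (v t - v s))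
    (s t : I) : edist (w s) (w t) ≤ ENNReal.ofReal |v t - v s| := by
  rcases le_total s t with h | h
  · exact (hw s t h).trans (ENNReal.ofReal_le_ofReal (le_abs_self _))
  · rw [edist_comm, abs_sub_comm]
    exact (hw t s h).trans (ENNReal.ofReal_le_ofReal (le_abs_self _))

theorem continuous_of_edist_le (hvc : Continuous v)
    (hw : ∀ s t, s ≤ t → edist (w s) (w t) ≤ ENNReal.ofReal (v t - v s)) : Continuous w := by
  refine continuous_iff_continuousAt.2 fun t => tendsto_iff_edist_tendsto_0.2 ?_
  refine tendsto_of_tendsto_of_tendsto_of_le_of_le tendsto_const_nhds ?_ (fun _ => zero_le)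
    (fun s => edist_le_ofReal_abs hw s t)
  have : Continuous fun s => ENNReal.ofReal |v t - v s| :=
    ENNReal.continuous_ofReal.comp (continuous_const.sub hvc).abs
  simpa using this.tendsto t

theorem eVariationOn_univ_le_of_edist_le (hv : Monotone v)
    (hw : ∀ s t, s ≤ t → edist (w s) (w t) ≤ ENNReal.ofReal (v t - v s)) :
    eVariationOn w univ ≤ ENNReal.ofReal (v 1 - v 0) := by
  refine iSup_le ?_
  rintro ⟨n, u, hu, -⟩
  calc ∑ i ∈ Finset.range n, edist (w (u (i + 1))) (w (u i))
      ≤ ∑ i ∈ Finset.range n, ENNReal.ofReal (v (u (i + 1)) - v (u i)) :=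
        Finset.sum_le_sum fun i _ => by rw [edist_comm]; exact hw _ _ (hu i.le_succ)
    _ = ENNReal.ofReal (∑ i ∈ Finset.range n, (v (u (i + 1)) - v (u i))) :=
        (ENNReal.ofReal_sum_of_nonneg fun i _ => sub_nonneg.2 (hv (hu i.le_succ))).symm
    _ ≤ _ := by
        rw [Finset.sum_range_sub fun i => v (u i)]
        exact ENNReal.ofReal_le_ofReal (sub_le_sub (hv (u n).2.2) (hv (u 0).2.1))

/-- A curve of finite length is controlled by its continuous arc length function. -/
theorem exists_control_of_pathLength_lt_top {x y : X} (γ : Path x y) (h : pathLength γ < ∞) :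
    ∃ v : I → ℝ, Monotone v ∧ Continuous v ∧
      ∀ s t, s ≤ t → edist (γ s) (γ t) ≤ ENNReal.ofReal (v t - v s) := by
  have hbv : BoundedVariationOn γ univ := h.ne
  have hfin : ∀ s : Set I, eVariationOn γ s ≠ ∞ := fun s => hbv.mono (subset_univ s)
  have hsub : ∀ s t : I, s ≤ t → variationOnFromTo γ univ 0 t - variationOnFromTo γ univ 0 s =
      (eVariationOn γ (Icc s t)).toReal := by
    intro s t hst
    have := variationOnFromTo.add hbv.locallyBoundedVariationOn (mem_univ 0) (mem_univ s)
      (mem_univ t)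
    rw [← this, add_sub_cancel_left, variationOnFromTo.eq_of_le _ _ hst, univ_inter]
  have hmono : Monotone (variationOnFromTo γ univ 0) := fun s t hst =>
    sub_nonneg.1 (by rw [hsub s t hst]; exact ENNReal.toReal_nonneg)
  refine ⟨variationOnFromTo γ univ 0, hmono, ?_, fun s t hst => ?_⟩
  · refine continuous_iff_continuousAt.2 fun t => tendsto_iff_dist_tendsto_zero.2 ?_
    have h1 := hbv.tendsto_eVariationOn_Icc_zero_left (x := t)
      γ.continuous.continuousAt.continuousWithinAt
    have h2 := hbv.tendsto_eVariationOn_Icc_zero_right t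
      γ.continuous.continuousAt.continuousWithinAt
    simp only [univ_inter, nhdsWithin_univ] at h1 h2
    -- A continuous curve of bounded variation has no jumps of arc length on either side of `t`. The
    -- sum of the two one-sided variations bounds the increment whichever side `s` lies on.
    have h3 := ((ENNReal.tendsto_toReal ENNReal.zero_ne_top).comp h1).add
      ((ENNReal.tendsto_toReal ENNReal.zero_ne_top).comp h2)
    simp only [ENNReal.toReal_zero, add_zero] at h3
    refine squeeze_zero (fun _ => dist_nonneg) (fun s => ?_) h3
    rw [Real.dist_eq]
    rcases le_total s t with hst | hst
    · rw [abs_sub_comm, hsub s t hst, abs_of_nonneg ENNReal.toReal_nonneg]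
      exact le_add_of_nonneg_right ENNReal.toReal_nonneg
    · rw [hsub t s hst, abs_of_nonneg ENNReal.toReal_nonneg]
      exact le_add_of_nonneg_left ENNReal.toReal_nonneg
  · rw [hsub s t hst, ENNReal.ofReal_toReal (hfin _)]
    exact eVariationOn.edist_le _ (left_mem_Icc.2 hst) (right_mem_Icc.2 hst)

end Curves

/-! ### Set-valued maps with closed graph, and chains -/

section Graph

variable {X : Type*} [EMetricSpace X] {F : X → Set X}

theorem exists_mem_edist_le_hausdorffEDist (hc : ∀ x, IsCompact (F x))
    (hne : ∀ x, (F x).Nonempty) {x y a : X} (ha : a ∈ F x) :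
    ∃ b ∈ F y, edist a b ≤ hausdorffEDist (F x) (F y) := by
  obtain ⟨b, hb, hab⟩ := (hc y).exists_infEDist_eq_edist (hne y) a
  exact ⟨b, hb, hab ▸ infEDist_le_hausdorffEDist_of_mem ha⟩

/-- For graph points `q` near `(x, y)`, the distance from `y` to `F x` is at most `edist y q.2 +
edist x q.1`, which tends to 0. Only the nonexpansive bound around the limit point `x` enters. -/
theorem isClosed_graph (hc : ∀ x, IsCompact (F x))
    (hF : ∀ x, ∀ᶠ y in 𝓝 x, hausdorffEDist (F x) (F y) ≤ edist x y) :
    IsClosed {q : X × X | q.2 ∈ F q.1} := by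
  refine isClosed_iff_frequently.2 fun ⟨x, y⟩ hxy => ?_
  rw [mem_ofPred_eq, mem_iff_infEDist_zero_of_closed (hc x).isClosed]
  have hlim : Tendsto (fun q : X × X => edist y q.2 + edist x q.1) (𝓝 (x, y)) (𝓝 0) := by
    have : Continuous fun q : X × X => edist y q.2 + edist x q.1 := by fun_prop
    simpa using this.tendsto (x, y)
  by_contra hne
  have hpos : 0 < infEDist y (F x) := pos_iff_ne_zero.2 hne
  obtain ⟨q, hq, hlt, hH⟩ := (hxy.and_eventually ((hlim.eventually_lt_const hpos).and
    (continuous_fst.continuousAt.eventually (hF x)))).exists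
  refine hlt.not_ge ?_
  calc infEDist y (F x) ≤ infEDist q.2 (F x) + edist y q.2 := infEDist_le_infEDist_add_edist
    _ ≤ hausdorffEDist (F q.1) (F x) + edist y q.2 := by
        gcongr
        exact infEDist_le_hausdorffEDist_of_mem hq
    _ ≤ edist x q.1 + edist y q.2 := by
        gcongr
        rwa [hausdorffEDist_comm]
    _ = _ := add_comm _ _

end Graph

/-- A set-valued map on a compact metric space that strictly contracts the steps of
`r`-chains has a fixed point if the space is `r`-chainable. -/
theorem setFix_nonempty_of_chainable {X : Type*} [MetricSpace X] [CompactSpace X] [Nonempty X]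
    {F : X → Set X} (hc : ∀ x, IsCompact (F x)) (hne : ∀ x, (F x).Nonempty)
    {r : ℝ} (hr : 0 < r)
    (hF : ∀ x y, x ≠ y → dist x y ≤ r → hausdorffEDist (F x) (F y) < edist x y)
    (hchain : IsChainable X r) : (setFix F).Nonempty := by
  obtain ⟨x⟩ := ‹Nonempty X›
  obtain ⟨y, hy⟩ := hne x
  obtain ⟨m, c, rfl, rfl, hcr⟩ := hchain x y
  have hgraph : IsClosed {q : X × X | q.2 ∈ F q.1} := by
    refine isClosed_graph hc fun x => ?_
    filter_upwards [closedBall_mem_nhds x hr] with y hy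
    rcases eq_or_ne x y with rfl | hxy
    · simp
    · exact (hF x y hxy (by rwa [dist_comm])).le
  -- Chains are sequences of which only the first `m` steps are constrained, so they live in a
  -- compact product; `≤ r` in place of `< r` makes the set closed.
  let C : Set (ℕ → X) := {z | ∀ i < m, dist (z i) (z (i + 1)) ≤ r} ∩ {z | z m ∈ F (z 0)}
  have hC : IsCompact C := by
    refine (IsClosed.inter ?_ ?_).isCompact
    · simp only [ofPred_forall]
      exact isClosed_iInter fun i => isClosed_iInter fun _ =>
        isClosed_le (by fun_prop) continuous_const
    · exact hgraph.preimage (f := fun z : ℕ → X => (z 0, z m)) (by fun_prop)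
  obtain ⟨z, ⟨hzr, hzF⟩, hmin⟩ := hC.exists_isMinOn ⟨c, fun i hi => (hcr i hi).le, hy⟩
    (f := fun z => ∑ i ∈ Finset.range m, dist (z i) (z (i + 1))) (by fun_prop)
  choose b hbF hb using fun (i : ℕ) (a : F (z i)) =>
    exists_mem_edist_le_hausdorffEDist hc hne (y := z (i + 1)) a.2
  obtain ⟨w, hw0, hwF, hw⟩ : ∃ w : ℕ → X, w 0 = z m ∧ (∀ i, w i ∈ F (z i)) ∧
      ∀ i, edist (w i) (w (i + 1)) ≤ hausdorffEDist (F (z i)) (F (z (i + 1))) := by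
    let w : ∀ i, F (z i) := fun n =>
      Nat.rec (motive := fun i => F (z i)) ⟨z m, hzF⟩ (fun i a => ⟨b i a, hbF i a⟩) n
    exact ⟨fun i => w i, rfl, fun i => (w i).2, fun i => hb i (w i)⟩
  have hlt : ∀ i < m, z i ≠ z (i + 1) → dist (w i) (w (i + 1)) < dist (z i) (z (i + 1)) := by
    intro i hi hne
    have := (hw i).trans_lt (hF _ _ hne (hzr i hi))
    rwa [edist_dist, edist_dist, ENNReal.ofReal_lt_ofReal_iff (dist_pos.2 hne)] at this
  have hle : ∀ i < m, dist (w i) (w (i + 1)) ≤ dist (z i) (z (i + 1)) := by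
    intro i hi
    rcases eq_or_ne (z i) (z (i + 1)) with h | h
    · have := hw i
      rw [← h, hausdorffEDist_self, nonpos_iff_eq_zero, edist_eq_zero] at this
      simp [this]
    · exact (hlt i hi h).le
  -- The lift starts at `z m` and ends in `F (z m)`, the image of its own start.
  have hwC : w ∈ C := by
    refine ⟨fun i hi => (hle i hi).trans (hzr i hi), ?_⟩
    change w m ∈ F (w 0)
    rw [hw0]
    exact hwF m
  have hconst : ∀ i < m, z i = z (i + 1) := by
    by_contra! ⟨i, hi, hne⟩
    exact (isMinOn_iff.1 hmin _ hwC).not_gt (Finset.sum_lt_sum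
      (fun i hi => hle i (Finset.mem_range.1 hi)) ⟨i, Finset.mem_range.2 hi, hlt i hi hne⟩)
  have hz : ∀ i ≤ m, z i = z 0 := by
    intro i
    induction i with
    | zero => exact fun _ => rfl
    | succ i ih => exact fun hi => (hconst i hi).symm.trans (ih (Nat.le_of_succ_le hi))
  refine ⟨z 0, ?_⟩
  have := hz m le_rfl
  change z 0 ∈ F (z 0)
  change z m ∈ F (z 0) at hzF
  rwa [this] at hzF

/-! ### Iterated lifting of a rectifiable path -/

/-- A set-valued uniform pointwise contraction of a complete, rectifiably path-connected space
has a fixed point. -/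
theorem setFix_nonempty_of_uniform {X : Type*} [EMetricSpace X] [CompleteSpace X] [Nonempty X]
    {F : X → Set X} (hc : ∀ x, IsCompact (F x)) (hne : ∀ x, (F x).Nonempty)
    (hrect : IsRectifiablyPathConnected X) (hF : IsSetUniformPointwiseContraction F) :
    (setFix F).Nonempty := by
  obtain ⟨β, hβ, hN⟩ := hF
  have hloc : ∀ x, ∀ᶠ y in 𝓝 x, hausdorffEDist (F x) (F y) ≤ β * edist x y := by
    intro x
    obtain ⟨N, hN, hx, h⟩ := hN x
    exact eventually_of_mem (hN.mem_nhds hx) h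
  have hβ1 : (β : ℝ≥0∞) < 1 := by exact_mod_cast hβ
  have hgraph := isClosed_graph hc fun x => (hloc x).mono fun y hy =>
    hy.trans (mul_le_of_le_one_left' hβ1.le)
  obtain ⟨x⟩ := ‹Nonempty X›
  obtain ⟨y, hy⟩ := hne x
  obtain ⟨γ, hγ⟩ := hrect x y
  obtain ⟨v, hv, hvc, hγv⟩ := exists_control_of_pathLength_lt_top γ hγ
  -- The `n`-th path ends in the image of its start and moves at most `β ^ n` times as fast as the
  -- arc length `v` of the initial path. Its lift starts at `w 1` and ends in `F (w 1)`, so the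
  -- property recurs with `n + 1`.
  let P : ℕ → (I → X) → Prop := fun n w => w 1 ∈ F (w 0) ∧
    ∀ s t, s ≤ t → edist (w s) (w t) ≤ ENNReal.ofReal (β ^ n * v t - β ^ n * v s)
  have hstep : ∀ n (w : {w // P n w}), ∃ w', P (n + 1) w' ∧ w' 0 = w.1 1 := by
    rintro n ⟨w, hwF, hw⟩
    have hwc : Continuous w :=
      continuous_of_edist_le (v := fun t => β ^ n * v t) (continuous_const.mul hvc) hw
    obtain ⟨w', hw'0, hw'F, hw'⟩ := exists_selection_of_eventually (K := fun t => F (w t))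
      (v := fun t => β ^ (n + 1) * v t) (fun t => hc _)
      (hv.const_mul (by positivity)) (fun t => by
        filter_upwards [hwc.continuousAt.eventually (hloc (w t))] with s hs
        have h1 := edist_le_ofReal_abs (v := fun t => β ^ n * v t) hw t s
        calc _ ≤ _ := hs
          _ ≤ β * ENNReal.ofReal |β ^ n * v s - β ^ n * v t| := by gcongr
          _ = _ := by
            rw [← ENNReal.ofReal_coe_nnreal, ← ENNReal.ofReal_mul β.coe_nonneg]
            congr 1
            rw [← abs_of_nonneg β.coe_nonneg, ← abs_mul, abs_of_nonneg β.coe_nonneg]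
            congr 1
            ring) hwF
    refine ⟨w', ⟨?_, hw'⟩, hw'0⟩
    rw [hw'0]
    exact hw'F 1
  choose g hgP hg0 using hstep
  let w : ∀ n, {w // P n w} :=
    Nat.rec ⟨γ, by simpa using hy, by simpa using hγv⟩ fun n w => ⟨g n w, hgP n w⟩
  let x : ℕ → X := fun n => (w n).1 0
  have hx1 : ∀ n, x (n + 1) = (w n).1 1 := fun n => hg0 n (w n)
  have hcauchy : CauchySeq x := by
    refine cauchySeq_of_edist_le_geometric β (ENNReal.ofReal (v 1 - v 0)) hβ1
      ENNReal.ofReal_ne_top fun n => ?_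
    rw [hx1]
    refine ((w n).2.2 0 1 zero_le_one).trans_eq ?_
    rw [← mul_sub, mul_comm, ENNReal.ofReal_mul (sub_nonneg.2 (hv zero_le_one)),
      ENNReal.ofReal_pow β.coe_nonneg, ENNReal.ofReal_coe_nnreal]
  obtain ⟨l, hl⟩ := cauchySeq_tendsto_of_complete hcauchy
  refine ⟨l, hgraph.mem_of_tendsto (hl.prodMk_nhds (hl.comp (tendsto_add_atTop_nat 1)))
    (Eventually.of_forall fun n => ?_)⟩
  change x (n + 1) ∈ F (x n)
  rw [hx1]
  exact (w n).2.1

/-! ### Pointwise contractions along Lipschitz curves -/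

section Pointwise

variable {X : Type*} [EMetricSpace X] {F : X → Set X}

theorem IsSetPointwiseContraction.eventually_le (hF : IsSetPointwiseContraction F) (x : X) :
    ∀ᶠ y in 𝓝 x, hausdorffEDist (F x) (F y) ≤ edist x y := by
  obtain ⟨β, hβ, N, hN, hx, h⟩ := hF x
  filter_upwards [hN.mem_nhds hx] with y hy
  exact (h y hy).trans (mul_le_of_le_one_left' (by exact_mod_cast hβ.le))

theorem continuous_hausdorffEDist (hc : ∀ x, IsCompact (F x))
    (hF : ∀ x, ∀ᶠ y in 𝓝 x, hausdorffEDist (F x) (F y) ≤ edist x y) (y : X) :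
    Continuous fun x => hausdorffEDist (F x) (F y) := by
  let G : X → TopologicalSpace.Compacts X := fun x => ⟨F x, hc x⟩
  have hG : Continuous G := by
    refine continuous_iff_continuousAt.2 fun x => tendsto_iff_edist_tendsto_0.2 ?_
    have hlim : Tendsto (fun z => edist x z) (𝓝 x) (𝓝 0) := by
      have : Continuous fun z => edist x z := by fun_prop
      simpa using this.tendsto x
    refine tendsto_of_tendsto_of_tendsto_of_le_of_le' tendsto_const_nhds hlim
      (Eventually.of_forall fun _ => zero_le) ((hF x).mono fun z hz => ?_)
    rwa [TopologicalSpace.Compacts.edist_eq, hausdorffEDist_comm]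
  exact hG.edist (continuous_const (y := G y))

/-- The points around which `F` contracts with modulus `1 - 1 / k` up to distance `1 / k`. -/
def contractionLocus (F : X → Set X) (k : ℕ) : Set X :=
  {x | ∀ y, edist x y < (k : ℝ≥0∞)⁻¹ →
    hausdorffEDist (F x) (F y) ≤ (1 - (k : ℝ≥0∞)⁻¹) * edist x y}

/-- For fixed `y` the condition says that either `edist x y` is at least `1 / k` or an inequality
between continuous functions of `x` holds. Both are closed, the first because the ball in the
definition is open. -/
theorem isClosed_contractionLocus (hc : ∀ x, IsCompact (F x))
    (hF : ∀ x, ∀ᶠ y in 𝓝 x, hausdorffEDist (F x) (F y) ≤ edist x y) (k : ℕ) :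
    IsClosed (contractionLocus F k) := by
  simp only [contractionLocus, ofPred_forall, ← not_le, imp_iff_or_not, not_not]
  refine isClosed_iInter fun y => IsClosed.union ?_ ?_
  · exact isClosed_le (continuous_hausdorffEDist hc hF y)
      ((ENNReal.continuous_const_mul (ENNReal.sub_ne_top ENNReal.one_ne_top)).comp
        (continuous_id.edist continuous_const))
  · exact isClosed_le continuous_const (continuous_id.edist continuous_const)

theorem iUnion_contractionLocus (hF : IsSetPointwiseContraction F) :
    ⋃ k, contractionLocus F k = univ := by
  refine eq_univ_of_forall fun x => mem_iUnion.2 ?_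
  obtain ⟨β, hβ, N, hN, hx, h⟩ := hF x
  have hβ1 : (β : ℝ≥0∞) < 1 := by exact_mod_cast hβ
  obtain ⟨ε, hε, hεN⟩ := EMetric.mem_nhds_iff.1 (hN.mem_nhds hx)
  obtain ⟨k, hk⟩ := ENNReal.exists_inv_nat_lt
    (lt_min hε (tsub_pos_of_lt hβ1)).ne'
  refine ⟨k, fun y hy => (h y (hεN ?_)).trans ?_⟩
  · rw [mem_eball, edist_comm]
    exact hy.trans (hk.trans_le (min_le_left _ _))
  · gcongr
    have h1 := hk.le.trans (min_le_right _ _)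
    refine ENNReal.le_sub_of_add_le_left (ne_top_of_le_ne_top (by finiteness) h1) ?_
    calc (k : ℝ≥0∞)⁻¹ + β ≤ (1 - β) + β := by gcongr
      _ = 1 := tsub_add_cancel_of_le hβ1.le

/-- A pointwise contraction lifts a `D`-Lipschitz curve to a curve of length less than `D`. -/
theorem IsSetPointwiseContraction.exists_path_lt (hF : IsSetPointwiseContraction F)
    (hc : ∀ x, IsCompact (F x)) {γ : I → X} {D : ℝ} (hD : 0 < D)
    (hγ : ∀ s t : I, s ≤ t → edist (γ s) (γ t) ≤ ENNReal.ofReal (D * t - D * s))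
    {a : X} (ha : a ∈ F (γ 0)) :
    ∃ b ∈ F (γ 1), ∃ w : Path a b, pathLength w < ENNReal.ofReal D := by
  have hγc : Continuous γ :=
    continuous_of_edist_le (v := fun t => D * t) (by fun_prop) hγ
  -- Baire on the unit interval: countably many closed sets cover it, so one has interior. The
  -- interval found there is shrunk to a closed `[p, q]` on which a single modulus and radius work.
  obtain ⟨k, U, hU⟩ := nonempty_interior_of_iUnion_of_closed
    (fun k => (isClosed_contractionLocus hc hF.eventually_le k).preimage hγc)
    (by rw [← preimage_iUnion, iUnion_contractionLocus hF, preimage_univ])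
  obtain ⟨p₀, q₀, hpq₀, hsub⟩ := isOpen_interior.exists_Ioo_subset ⟨U, hU⟩
  obtain ⟨p, hp, hpq₀⟩ := exists_between hpq₀
  obtain ⟨q, hpq, hq⟩ := exists_between hpq₀
  have hloc : ∀ t ∈ Icc p q, γ t ∈ contractionLocus F k := fun t ht =>
    interior_subset (s := γ ⁻¹' contractionLocus F k) (hsub ⟨hp.trans_le ht.1, ht.2.trans_lt hq⟩)
  -- The value `k = 0` is allowed: then `k⁻¹ = ∞` and the modulus is 0.
  set β : ℝ≥0∞ := 1 - (k : ℝ≥0∞)⁻¹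
  have hβ : β < 1 := ENNReal.sub_lt_self ENNReal.one_ne_top one_ne_zero (by simp)
  obtain ⟨b, hb⟩ : ∃ b : ℝ≥0, (b : ℝ≥0∞) = β := ⟨β.toNNReal, ENNReal.coe_toNNReal hβ.ne_top⟩
  have hb1 : (b : ℝ) < 1 := by rw [← hb] at hβ; exact_mod_cast hβ
  have hb0 : (0 : ℝ) ≤ b := b.coe_nonneg
  -- Clamping to `[p, q]` lets `v` below have slope `D` outside `[p, q]` and `b * D` inside, so its
  -- total increase is `D - D * (1 - b) * (q - p) < D`.
  let c : I → ℝ := fun t => max p (min q t)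
  have hcc : Continuous c := by fun_prop
  have hcm : ∀ s t, s ≤ t → 0 ≤ c t - c s ∧ c t - c s ≤ (t : ℝ) - s := by
    intro s t hst
    have hst' : (s : ℝ) ≤ t := hst
    have hpq' : (p : ℝ) < q := hpq
    grind
  let v : I → ℝ := fun t => D * (t - (1 - b) * c t)
  have hvc : Continuous v := by fun_prop
  have hvb : ∀ s t, s ≤ t → b * (D * t - D * s) ≤ v t - v s := by
    intro s t hst
    have : v t - v s - b * (D * t - D * s) = D * (1 - b) * ((t : ℝ) - s - (c t - c s)) := by
      simp only [v]; ring
    have h2 : 0 ≤ D * (1 - b) * ((t : ℝ) - s - (c t - c s)) :=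
      mul_nonneg (mul_nonneg hD.le (by linarith)) (by linarith [hcm s t hst])
    linarith
  have hv : Monotone v := by
    intro s t hst
    have hst' : (s : ℝ) ≤ t := hst
    have := hvb s t hst
    have h2 : 0 ≤ b * (D * t - D * s) := by
      rw [← mul_sub]
      exact mul_nonneg hb0 (mul_nonneg hD.le (sub_nonneg.2 hst'))
    linarith
  have hvabs : ∀ s t : I, b * |D * s - D * t| ≤ |v s - v t| := by
    have hDm : ∀ s t : I, s ≤ t → 0 ≤ D * (t : ℝ) - D * s := fun s t hst =>
      sub_nonneg.2 (mul_le_mul_of_nonneg_left hst hD.le)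
    intro s t
    rcases le_total s t with hst | hst
    · rw [abs_sub_comm (v s), abs_sub_comm (D * _), abs_of_nonneg (hDm s t hst)]
      exact (hvb s t hst).trans (le_abs_self _)
    · rw [abs_of_nonneg (hDm t s hst)]
      exact (hvb t s hst).trans (le_abs_self _)
  have hγabs := edist_le_ofReal_abs (v := fun t : I => D * t) hγ
  -- Off `[p, q]` the clamp is locally constant and nonexpansiveness suffices. The endpoints `p` and
  -- `q` count as inside: the modulus `β` holds there on both sides, and `v` has slope at least `b *
  -- D` everywhere.
  have hvloc : ∀ t, ∀ᶠ s in 𝓝 t,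
      hausdorffEDist (F (γ t)) (F (γ s)) ≤ ENNReal.ofReal |v s - v t| := by
    intro t
    have hout : (∀ᶠ s in 𝓝 t, c s = c t) →
        ∀ᶠ s in 𝓝 t, hausdorffEDist (F (γ t)) (F (γ s)) ≤ ENNReal.ofReal |v s - v t| := by
      intro hct
      filter_upwards [hct, hγc.continuousAt.eventually (hF.eventually_le (γ t))] with s hs hle
      refine hle.trans ((hγabs t s).trans_eq ?_)
      congr 2
      simp only [v, hs]
      ring
    rcases lt_or_ge t p with htp | htp
    · refine hout ?_
      filter_upwards [eventually_lt_nhds htp] with s hs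
      have h1 : (s : ℝ) < p := hs
      have h2 : (t : ℝ) < p := htp
      grind
    rcases lt_or_ge q t with hqt | hqt
    · refine hout ?_
      filter_upwards [eventually_gt_nhds hqt] with s hs
      have h1 : (q : ℝ) < s := hs
      have h2 : (q : ℝ) < t := hqt
      grind
    have hlim : Tendsto (fun s => edist (γ t) (γ s)) (𝓝 t) (𝓝 0) := by
      have : Continuous fun s => edist (γ t) (γ s) := by fun_prop
      simpa using this.tendsto t
    filter_upwards [hlim.eventually_lt_const (u := (k : ℝ≥0∞)⁻¹) (by simp)] with s hs
    calc hausdorffEDist (F (γ t)) (F (γ s)) ≤ β * edist (γ t) (γ s) := hloc t ⟨htp, hqt⟩ _ hs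
      _ ≤ β * ENNReal.ofReal |D * s - D * t| := by gcongr; exact hγabs t s
      _ = ENNReal.ofReal (b * |D * s - D * t|) := by
        rw [← hb, ENNReal.ofReal_mul hb0, ENNReal.ofReal_coe_nnreal]
      _ ≤ _ := ENNReal.ofReal_le_ofReal (hvabs s t)
  obtain ⟨w, hw0, hwF, hw⟩ :=
    exists_selection_of_eventually (K := fun t => F (γ t)) (fun t => hc _) hv hvloc ha
  refine ⟨w 1, hwF 1, ⟨⟨w, continuous_of_edist_le hvc hw⟩, hw0, rfl⟩, ?_⟩
  refine (eVariationOn_univ_le_of_edist_le hv hw).trans_lt ?_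
  rw [ENNReal.ofReal_lt_ofReal_iff hD]
  have hc1 : c 1 = q := by
    have h1 : (p : ℝ) < q := hpq
    have h2 : (q : ℝ) ≤ 1 := q.2.2
    simp [c, h1.le, h2]
  have hc0 : c 0 = p := by
    have h1 : (0 : ℝ) ≤ q := q.2.1
    have h2 : (0 : ℝ) ≤ p := p.2.1
    simp [c, h1, h2]
  have hpos : 0 < D * (1 - b) * ((q : ℝ) - p) :=
    mul_pos (mul_pos hD (by linarith)) (sub_pos.2 hpq)
  have : v 1 - v 0 = D - D * (1 - b) * ((q : ℝ) - p) := by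
    simp only [v, hc1, hc0, Icc.coe_one, Icc.coe_zero]
    ring
  linarith

end Pointwise

/-! ### Geodesics in compact length spaces -/

section Geodesics

variable {Y : Type*} [EMetricSpace Y] [CompactSpace Y]

/-- On an almost shortest curve the intermediate value theorem gives a point at distance exactly `δ`
from `x`. Minimising the distance to `y` over the compact sphere of radius `δ` removes the error
`ε`. -/
theorem exists_edist_eq_of_approx
    (hY : ∀ x y : Y, ∀ ε : ℝ≥0, 0 < ε → ∃ f : I → Y, Continuous f ∧ f 0 = x ∧ f 1 = y ∧
      ∀ t, edist x (f t) + edist (f t) y ≤ edist x y + ε)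
    (x y : Y) {δ : ℝ≥0∞} (hδ : δ ≤ edist x y) :
    ∃ z, edist x z = δ ∧ δ + edist z y ≤ edist x y := by
  have key : ∀ ε : ℝ≥0, 0 < ε → ∃ z, edist x z = δ ∧ δ + edist z y ≤ edist x y + ε := by
    intro ε hε
    obtain ⟨f, hf, hf0, hf1, hfε⟩ := hY x y ε hε
    obtain ⟨t, ht⟩ := mem_range_of_exists_le_of_exists_ge (c := δ) (f := fun t => edist x (f t))
      (by fun_prop) ⟨0, by simp [hf0]⟩ ⟨1, by simpa [hf1] using hδ⟩
    exact ⟨f t, ht, by simpa only [← ht] using hfε t⟩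
  have hC : IsCompact {z | edist x z = δ} :=
    (isClosed_eq (by fun_prop) continuous_const).isCompact
  obtain ⟨z₁, hz₁, -⟩ := key 1 one_pos
  obtain ⟨z, hz, hmin⟩ := hC.exists_isMinOn ⟨z₁, hz₁⟩ (f := fun z => edist z y) (by fun_prop)
  refine ⟨z, hz, ENNReal.le_of_forall_pos_le_add fun ε hε _ => ?_⟩
  obtain ⟨z', hz', hle⟩ := key ε hε
  exact (add_le_add_right (isMinOn_iff.1 hmin z' hz') δ).trans hle

/-- A geodesic is a selection of the shrinking balls of radius `D - D * t` around `y`. The preceding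
lemma supplies the move from one ball to a later one, unless `y` itself is within reach, and the
ball at time 1 is `{y}`. -/
theorem exists_geodesic_of_approx
    (hY : ∀ x y : Y, ∀ ε : ℝ≥0, 0 < ε → ∃ f : I → Y, Continuous f ∧ f 0 = x ∧ f 1 = y ∧
      ∀ t, edist x (f t) + edist (f t) y ≤ edist x y + ε)
    {x y : Y} {D : ℝ} (hD : 0 ≤ D) (hxy : edist x y ≤ ENNReal.ofReal D) :
    ∃ γ : I → Y, γ 0 = x ∧ γ 1 = y ∧
      ∀ s t : I, s ≤ t → edist (γ s) (γ t) ≤ ENNReal.ofReal (D * t - D * s) := by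
  obtain ⟨γ, hγ0, hγK, hγ⟩ := exists_selection
    (K := fun t : I => {z : Y | edist z y ≤ ENNReal.ofReal (D - D * t)})
    (v := fun t : I => D * t) (a := x)
    (fun t => (isClosed_le (by fun_prop) continuous_const).isCompact)
    (fun s t hst => mul_le_mul_of_nonneg_left hst hD) (fun s t hst a ha => by
      rcases le_total (edist a y) (ENNReal.ofReal (D * t - D * s)) with h | h
      · exact ⟨y, by simp, h⟩
      · obtain ⟨z, hz, hzy⟩ := exists_edist_eq_of_approx hY a y h
        refine ⟨z, ?_, hz.le⟩
        have h1 : D * s ≤ D * t := mul_le_mul_of_nonneg_left hst hD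
        have h2 : D * t ≤ D := mul_le_of_le_one_right hD t.2.2
        have h3 := hzy.trans ha
        rw [← ofReal_sub_add_ofReal_sub h1 h2] at h3
        exact (ENNReal.add_le_add_iff_left ENNReal.ofReal_ne_top).1 h3)
    (by simpa using hxy)
  refine ⟨γ, hγ0, ?_, hγ⟩
  have := hγK 1
  simpa using this

/-- A set-valued map on a compact geodesic space that strictly contracts along Lipschitz curves
has a fixed point. -/
theorem setFix_nonempty_of_lipschitz_curves [Nonempty Y] {F : Y → Set Y}
    (hY : ∀ x y : Y, ∀ ε : ℝ≥0, 0 < ε → ∃ f : I → Y, Continuous f ∧ f 0 = x ∧ f 1 = y ∧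
      ∀ t, edist x (f t) + edist (f t) y ≤ edist x y + ε)
    (hfin : ∀ x y : Y, edist x y ≠ ∞) (hne : ∀ x, (F x).Nonempty)
    (hgraph : IsClosed {q : Y × Y | q.2 ∈ F q.1})
    (hF : ∀ (γ : I → Y) (D : ℝ), 0 < D →
      (∀ s t : I, s ≤ t → edist (γ s) (γ t) ≤ ENNReal.ofReal (D * t - D * s)) →
      ∀ a ∈ F (γ 0), ∃ b ∈ F (γ 1), edist a b < ENNReal.ofReal D) :
    (setFix F).Nonempty := by
  obtain ⟨x₀⟩ := ‹Nonempty Y›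
  obtain ⟨y₀, hy₀⟩ := hne x₀
  obtain ⟨⟨x, y⟩, hxy, hmin⟩ := hgraph.isCompact.exists_isMinOn ⟨(x₀, y₀), hy₀⟩
    (f := fun q => edist q.1 q.2) (by fun_prop)
  have hxy : y ∈ F x := hxy
  rcases eq_or_ne x y with rfl | hne
  · exact ⟨x, hxy⟩
  have hD : 0 < (edist x y).toReal := ENNReal.toReal_pos (edist_pos.2 hne).ne' (hfin x y)
  obtain ⟨γ, rfl, rfl, hγ⟩ :=
    exists_geodesic_of_approx hY hD.le (ENNReal.ofReal_toReal (hfin x y)).ge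
  obtain ⟨b, hb, hlt⟩ := hF γ _ hD hγ _ hxy
  rw [ENNReal.ofReal_toReal (hfin _ _)] at hlt
  exact absurd (isMinOn_iff.1 hmin (γ 1, b) hb) hlt.not_ge

end Geodesics

/-! ### Comparison of the metrics `d` and `d_r` -/

namespace LengthSpace

variable {X : Type*} [EMetricSpace X]

/-- The identity map from the length metric to the original metric. -/
def toBase (x : LengthSpace X) : X := x

theorem edist_toBase_le (x y : LengthSpace X) : edist (toBase x) (toBase y) ≤ edist x y :=
  le_iInf fun γ : Path (X := X) x y => edist_le_pathLength γ

theorem edist_le_of_path {x y : LengthSpace X} (γ : Path (toBase x) (toBase y)) :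
    edist x y ≤ pathLength γ :=
  iInf_le (fun γ : Path (X := X) x y => pathLength γ) γ

theorem continuous_toBase : Continuous (toBase : LengthSpace X → X) :=
  (LipschitzWith.of_edist_le edist_toBase_le).continuous

/-- The identity map from the original metric to the length metric. -/
def ofBase (x : X) : LengthSpace X := x

/-- The identity from compact `d_r` to Hausdorff `d` is a continuous bijection, hence a
homeomorphism. Thus `d`-continuous paths are also `d_r`-continuous. -/
theorem continuous_ofBase [CompactSpace (LengthSpace X)] :
    Continuous (ofBase : X → LengthSpace X) :=
  Continuous.continuous_symm_of_equiv_compact_to_t2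
    (f := ⟨toBase, ofBase, fun _ => rfl, fun _ => rfl⟩) continuous_toBase

theorem edist_ne_top (h : IsRectifiablyPathConnected X) (x y : LengthSpace X) :
    edist x y ≠ ∞ := by
  obtain ⟨γ, hγ⟩ := h (toBase x) (toBase y)
  exact ((edist_le_of_path γ).trans_lt hγ).ne

theorem edist_le_eVariationOn {x y : X} (γ : Path x y) {s t : I} (hst : s ≤ t) :
    edist (α := LengthSpace X) (γ s) (γ t) ≤ eVariationOn γ (Icc s t) := by
  refine (edist_le_of_path (x := (γ s : LengthSpace X)) (y := γ t) (γ.subpath s t)).trans ?_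
  refine eVariationOn.comp_le_of_monotoneOn γ (Icc.convexComb s t) ?_ ?_
  · intro a _ b _ hab
    have h1 : (s : ℝ) ≤ t := hst
    have h2 : (a : ℝ) ≤ b := hab
    rw [← Subtype.coe_le_coe, Icc.coe_convexComb, Icc.coe_convexComb]
    nlinarith [mul_nonneg (sub_nonneg.2 h1) (sub_nonneg.2 h2)]
  · intro a _
    have := mem_range_self (f := Icc.convexComb s t) a
    rw [Path.range_subpathAux, uIcc_of_le hst] at this
    exact this

/-- A path of `d`-length below `d_r (x, y) + ε` works: its length splits at any time `t`, and each
piece bounds the `d_r`-distance of its endpoints. -/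
theorem exists_approx [CompactSpace (LengthSpace X)] (h : IsRectifiablyPathConnected X)
    (x y : LengthSpace X) (ε : ℝ≥0) (hε : 0 < ε) :
    ∃ f : I → LengthSpace X, Continuous f ∧ f 0 = x ∧ f 1 = y ∧
      ∀ t, edist x (f t) + edist (f t) y ≤ edist x y + ε := by
  have hlt : (⨅ γ : Path (toBase x) (toBase y), pathLength γ) < edist x y + ε :=
    ENNReal.lt_add_right (edist_ne_top h x y) (by exact_mod_cast hε.ne')
  obtain ⟨γ, hγ⟩ := iInf_lt_iff.1 hlt
  refine ⟨fun t => ofBase (γ t), continuous_ofBase.comp γ.continuous, γ.source, γ.target,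
    fun t => le_trans ?_ hγ.le⟩
  have h0 := edist_le_eVariationOn γ (s := 0) (t := t) t.2.1
  have h1 := edist_le_eVariationOn γ (s := t) (t := 1) t.2.2
  rw [γ.source] at h0
  rw [γ.target] at h1
  refine (add_le_add h0 h1).trans_eq ?_
  have := eVariationOn.Icc_add_Icc γ (s := univ) (a := 0) (b := t) (c := 1) t.2.1 t.2.2 (mem_univ t)
  simp only [univ_inter] at this
  rw [this, pathLength]
  congr 1
  exact eq_univ_of_forall fun t => ⟨t.2.1, t.2.2⟩

theorem setFix_nonempty_of_pointwise [CompactSpace (LengthSpace X)] [Nonempty X]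
    (h : IsRectifiablyPathConnected X) {F : X → Set X} (hc : ∀ x, IsCompact (F x))
    (hne : ∀ x, (F x).Nonempty)
    (hF : IsSetPointwiseContraction F ∨ IsSetPointwiseContraction (onLengthSpace F)) :
    (setFix F).Nonempty := by
  have : Nonempty (LengthSpace X) := ‹Nonempty X›
  -- The values are `d`-closed, hence `d_r`-closed in a `d_r`-compact space.
  have hcL : ∀ x, IsCompact (onLengthSpace F x) := fun x =>
    ((hc x).isClosed.preimage continuous_toBase).isCompact
  suffices (setFix (onLengthSpace F)).Nonempty from this
  refine hF.elim (fun hF => ?_) fun hF => ?_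
  · refine setFix_nonempty_of_lipschitz_curves (exists_approx h) (edist_ne_top h) hne ?_ ?_
    · exact (isClosed_graph hc hF.eventually_le).preimage
        (continuous_toBase.prodMap continuous_toBase)
    -- A `d_r`-geodesic is also Lipschitz for `d` with the same constant, and the `d`-length of the
    -- lifted path bounds the `d_r`-distance of its ends. So contraction in `d` still shortens
    -- `d_r`.
    · intro γ D hD hγ a ha
      obtain ⟨b, hb, w, hw⟩ := hF.exists_path_lt hc (γ := fun t => toBase (γ t)) hD
        (fun s t hst => (edist_toBase_le _ _).trans (hγ s t hst)) ha
      exact ⟨b, hb, (edist_le_of_path w).trans_lt hw⟩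
  · refine setFix_nonempty_of_lipschitz_curves (exists_approx h) (edist_ne_top h) hne
      (isClosed_graph hcL hF.eventually_le) ?_
    intro γ D hD hγ a ha
    obtain ⟨b, hb, w, hw⟩ := hF.exists_path_lt hcL hD hγ ha
    exact ⟨b, hb, (edist_le_pathLength w).trans_lt hw⟩

end LengthSpace

/-! ### From fixed points to Nash equilibria -/

theorem isPureNash_of_mem_bestResponse {n : ℕ} {S : Fin n → Type*} {p : ℝ≥0∞}
    {u : Fin n → (∀ i, S i) → ℝ} {x : PiLp p S} (hx : x ∈ bestResponse p u x) :
    IsPureNash u (fun i => x i) := by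
  intro i b
  have := hx i b
  rwa [Function.update_eq_self i (fun j => x j)] at this

theorem corollary20 {n : ℕ} {S : Fin n → Type*} [∀ i, MetricSpace (S i)] [∀ i, Nonempty (S i)]
    (p : ℝ≥0∞) [Fact (1 ≤ p)] (u : Fin n → (∀ i, S i) → ℝ)
    (hBR : ∀ x, (bestResponse p u x).Nonempty ∧ IsCompact (bestResponse p u x))
    (h :
      (CompactSpace (PiLp p S) ∧
        ∃ (β : PiLp p S → ℝ≥0) (ρ : PiLp p S → ℝ) (r : ℝ),
          IsSetLocalContraction β ρ (bestResponse p u) ∧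
          0 < r ∧ (∀ x, r ≤ ρ x) ∧ IsChainable (PiLp p S) r) ∨
      (CompleteSpace (PiLp p S) ∧ IsRectifiablyPathConnected (PiLp p S) ∧
        IsSetUniformPointwiseContraction (bestResponse p u)) ∨
      (CompactSpace (LengthSpace (PiLp p S)) ∧ IsRectifiablyPathConnected (PiLp p S) ∧
        (IsSetPointwiseContraction (bestResponse p u) ∨
          IsSetPointwiseContraction (onLengthSpace (bestResponse p u))))) :
    ∃ x : PiLp p S, x ∈ setFix (bestResponse p u) ∧ IsPureNash u (fun i => x i) := by
  have : Nonempty (PiLp p S) := ⟨WithLp.toLp p fun i => Classical.arbitrary (S i)⟩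
  suffices (setFix (bestResponse p u)).Nonempty from
    this.imp fun x hx => ⟨hx, isPureNash_of_mem_bestResponse hx⟩
  have hne := fun x => (hBR x).1
  have hc := fun x => (hBR x).2
  rcases h with ⟨hX, β, ρ, r, hF, hr, hrρ, hchain⟩ | ⟨hX, hrect, hF⟩ | ⟨hX, hrect, hF⟩
  -- Each pair at distance at most `r` lies in the ball of radius `ρ x` around its first point `x`,
  -- where the modulus `β x < 1` gives the strict inequality for distinct points.
  · refine setFix_nonempty_of_chainable hc hne hr (fun x y hxy hd => ?_) hchain
    obtain ⟨hρ, hβ, hβF⟩ := hF x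
    refine (hβF x (mem_closedBall_self hρ.le) y ?_).trans_lt ?_
    · rw [mem_closedBall, dist_comm]
      exact hd.trans (hrρ x)
    · calc (β x : ℝ≥0∞) * edist x y < 1 * edist x y :=
          ENNReal.mul_lt_mul_left (edist_pos.2 hxy).ne' (edist_ne_top x y) (by exact_mod_cast hβ)
        _ = edist x y := one_mul _
  · exact setFix_nonempty_of_uniform hc hne hrect hF
  · exact LengthSpace.setFix_nonempty_of_pointwise hrect hc hne hF
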